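/- Let $B_r=\{x\in\mathbb{R}^3 : |x|<r\}$, $\rho=|x|$, and let $S^2=\partial B_1$ be the unit sphere (the cosmological horizon of de Sitter space) with its standard surface measure $d\sigma$. For $s\in\mathbb{C}$ let $$L_s u=-\sum_{i,j=1}^3(\delta_{ij}-x_ix_j)\,\partial_i\partial_j u+4\sum_{i=1}^3x_i\partial_i u+2u+2s\Big(\sum_{i=1}^3x_i\partial_i u+\tfrac32 u\Big)+s^2u .$$ Let $\epsilon>0$ and $m\in\mathbb{N}_0$, and let $s\in\mathbb{C}$ with $\operatorname{Re}s>\tfrac12-(m+1)$. A distribution $\theta\in\mathcal{D}'(B_{1+\epsilon})$ is called a quasinormal co-mode of Sobolev order $m$ at the frequency $s$ if (i) there exists $C>0$ such that $|\theta(u)|\le C\|u\|_{H^m(B_1)}$ for all $u\in C_c^\infty(B_{1+\epsilon})$, where $\|u\|_{H^m(B_1)}^2=\sum_{|\alpha|\le m}\int_{B_1}|\partial^\alpha u|^2\,dx$; (ii) $\theta(L_su)=0$ for all $u\in C_c^\infty(B_{1+\epsilon})$. Let $\Theta_{00}(f)=\int_{S^2}Y_{00}f\,d\sigma$ with $Y_{00}=1/\sqrt{4\pi}$,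 and let $\tilde Du=\rho^{-1}\big(\sum_{i=1}^3x_i\partial_iu+u\big)=\rho^{-1}\partial_\rho(\rho u)$ for $\rho>0$. For $k\in\mathbb{N}_0$ let $\tilde D^k\Theta_{00}$ be given by $(\tilde D^k\Theta_{00})(f)=(-1)^k\,\Theta_{00}(\tilde D^kf)$ for $f\in C_c^\infty(B_{1+\epsilon})$. Proposition. For every $\epsilon>0$ and every $k\in\mathbb{N}_0$, $\tilde D^k\Theta_{00}$ is a nonzero distribution on $B_{1+\epsilon}$, it is a quasinormal co-mode of Sobolev order $k+1$ at the frequency $s=-k-1$, and its support is contained in $S^2$; that is, it is concentrated on the cosmological horizon. -/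

import Mathlib

open MeasureTheory TopologicalSpace
open scoped Distributions ContDiff

namespace DeSitter

noncomputable section

/-- Euclidean three-space. -/
abbrev R3 : Type := EuclideanSpace ℝ (Fin 3)

/-- The open ball `B_{1+ε}` of radius `1 + ε` around the origin, as an open set. -/
def bigBall (ε : ℝ) : Opens R3 := ⟨Metric.ball (0 : R3) (1 + ε), Metric.isOpen_ball⟩

/-- Complex test functions `C_c^∞(B_{1+ε})`. -/
abbrev Test (ε : ℝ) : Type := 𝓓(bigBall ε, ℂ)

/-- Complex distributions on `B_{1+ε}`: continuous `ℂ`-linear functionals on `C_c^∞(B_{1+ε})` with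
its canonical LF topology. -/
abbrev Dist (ε : ℝ) : Type := Test ε →L[ℂ] ℂ

/-- The partial derivative `∂_i u`. -/
def pderiv (i : Fin 3) (u : R3 → ℂ) (x : R3) : ℂ := fderiv ℝ u x (EuclideanSpace.single i 1)

/-- The radial operator `∑ i, x_i ∂_i u = ρ ∂_ρ u`. -/
def euler (u : R3 → ℂ) (x : R3) : ℂ := ∑ i, (x i : ℂ) * pderiv i u x

/-- `L₀ u = -∑ i j, (δ_ij - x_i x_j) ∂_i ∂_j u + 4 ∑ i, x_i ∂_i u + 2 u`. -/
def opL0 (u : R3 → ℂ) (x : R3) : ℂ :=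
  -(∑ i, ∑ j, ((if i = j then 1 else 0) - (x i : ℂ) * (x j : ℂ)) * pderiv i (pderiv j u) x)
    + 4 * euler u x + 2 * u x

/-- `P u = ∑ i, x_i ∂_i u + (3/2) u`. -/
def opP (u : R3 → ℂ) (x : R3) : ℂ := euler u x + 3 / 2 * u x

/-- `L_s = L₀ + 2 s P + s²`. -/
def opL (s : ℂ) (u : R3 → ℂ) (x : R3) : ℂ := opL0 u x + 2 * s * opP u x + s ^ 2 * u x

theorem contDiff_pderiv {u : R3 → ℂ} (hu : ContDiff ℝ ∞ u) (i : Fin 3) :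
    ContDiff ℝ ∞ (pderiv i u) :=
  (hu.fderiv_right (m := ∞) (by simp)).clm_apply contDiff_const

theorem contDiff_coord (i : Fin 3) : ContDiff ℝ ∞ (fun x : R3 => (x i : ℂ)) :=
  Complex.ofRealCLM.contDiff.comp (EuclideanSpace.proj (𝕜 := ℝ) i).contDiff

theorem contDiff_euler {u : R3 → ℂ} (hu : ContDiff ℝ ∞ u) : ContDiff ℝ ∞ (euler u) :=
  ContDiff.sum fun i _ => (contDiff_coord i).mul (contDiff_pderiv hu i)

theorem contDiff_opL {u : R3 → ℂ} (s : ℂ) (hu : ContDiff ℝ ∞ u) : ContDiff ℝ ∞ (opL s u) := by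
  have hE := contDiff_euler hu
  have h0 : ContDiff ℝ ∞ (opL0 u) := by
    refine ((ContDiff.sum fun i _ => ContDiff.sum fun j _ => ?_).neg.add
      (contDiff_const.mul hE)).add (contDiff_const.mul hu)
    exact (contDiff_const.sub ((contDiff_coord i).mul (contDiff_coord j))).mul
      (contDiff_pderiv (contDiff_pderiv hu j) i)
  have hP : ContDiff ℝ ∞ (opP u) := hE.add (contDiff_const.mul hu)
  exact (h0.add (contDiff_const.mul hP)).add (contDiff_const.mul hu)

theorem pderiv_eq_zero {u : R3 → ℂ} {x : R3} (hx : x ∉ tsupport u) (i : Fin 3) :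
    pderiv i u x = 0 := by
  have h : fderiv ℝ u x = 0 :=
    image_eq_zero_of_notMem_tsupport fun h => hx (tsupport_fderiv_subset ℝ h)
  simp [pderiv, h]

theorem tsupport_pderiv_subset (u : R3 → ℂ) (i : Fin 3) : tsupport (pderiv i u) ⊆ tsupport u :=
  closure_minimal (fun _ hx => by_contra fun h => hx (pderiv_eq_zero h i)) (isClosed_tsupport u)

theorem tsupport_opL_subset (s : ℂ) (u : R3 → ℂ) : tsupport (opL s u) ⊆ tsupport u := by
  refine closure_minimal (fun x hx => by_contra fun h => hx ?_) (isClosed_tsupport u)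
  have h0 : u x = 0 := image_eq_zero_of_notMem_tsupport h
  have h2 : ∀ i j, pderiv i (pderiv j u) x = 0 := fun i j =>
    pderiv_eq_zero (fun hh => h (tsupport_pderiv_subset u j hh)) i
  simp [opL, opL0, opP, euler, h0, h2, pderiv_eq_zero h]

/-- `L_s` as a map from test functions to test functions. -/
def testL {ε : ℝ} (s : ℂ) (u : Test ε) : Test ε where
  toFun := opL s u
  contDiff' := contDiff_opL s u.contDiff
  hasCompactSupport' := u.hasCompactSupport.of_isClosed_subset (isClosed_tsupport _)
    (tsupport_opL_subset s u)
  tsupport_subset' := (tsupport_opL_subset s u).trans u.tsupport_subset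

/-- `∂^α u = ∂_1^{α_1} ∂_2^{α_2} ∂_3^{α_3} u` for a multi-index `α`. -/
def multiDeriv (α : Fin 3 → ℕ) (u : R3 → ℂ) : R3 → ℂ :=
  (pderiv 0)^[α 0] ((pderiv 1)^[α 1] ((pderiv 2)^[α 2] u))

/-- The norm of `H^m(B_1)` of (the restriction to the open unit ball of) a smooth function `u`:
the square root of the sum over all `|α| ≤ m` of `∫_{B_1} |∂^α u|²`. -/
def sobolevNorm (m : ℕ) (u : R3 → ℂ) : ℝ :=
  √(∑ j ∈ Finset.range (m + 1), ∑ α ∈ Finset.piAntidiag (Finset.univ : Finset (Fin 3)) j,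
    ∫ x in Metric.ball (0 : R3) 1, ‖multiDeriv α u x‖ ^ 2)

/-- `θ` is a quasinormal co-mode of Sobolev order `m` at the frequency `s`. The first condition
places `s` in the half-plane in which `L_s : D^{m+1}(L_s) → H^m(B_1)` is considered, which is
`Re s > 1/2 - (m + 1)`. -/
structure IsCoMode {ε : ℝ} (m : ℕ) (s : ℂ) (θ : Dist ε) : Prop where
  re_gt : 1 / 2 - ((m : ℝ) + 1) < s.re
  bounded : ∃ C : ℝ, 0 < C ∧ ∀ u : Test ε, ‖θ u‖ ≤ C * sobolevNorm m u
  annihilates : ∀ u : Test ε, θ (testL s u) = 0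

/-- The constant spherical harmonic `Y_00 = 1 / √(4π)`. -/
def Y00 : ℂ := ((1 / √(4 * Real.pi) : ℝ) : ℂ)

/-- `Θ_00 (f) = ∫_{S²} Y_00 f dσ`, with `σ` the standard surface measure of the unit sphere. -/
def Theta00 (f : R3 → ℂ) : ℂ :=
  ∫ x : Metric.sphere (0 : R3) 1, Y00 * f x ∂(volume : Measure R3).toSphere

/-- `D̃ u = ρ⁻¹ (∑ i, x_i ∂_i u + u) = ρ⁻¹ ∂_ρ (ρ u)`, for `x ≠ 0`. -/
def twistedD (u : R3 → ℂ) (x : R3) : ℂ := ((‖x‖⁻¹ : ℝ) : ℂ) * (euler u x + u x)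

/-- The value of `D̃^k Θ_00` at `f`. The operator `D̃` is formally anti-self-adjoint with respect to
Lebesgue measure, so `(D̃^k Θ_00)(f) = (-1)^k Θ_00(D̃^k f)`; here `D̃^k f` is smooth away from the
origin, and only its restriction to the unit sphere matters. -/
def twistedTheta (k : ℕ) (f : R3 → ℂ) : ℂ := (-1) ^ k * Theta00 (twistedD^[k] f)

end

end DeSitter

namespace DeSitter

noncomputable section

/-! ### Partial derivatives -/

/-! The problem reduces to an ordinary differential equation for spherical means. Put F_k(r) = r
∫_{S²} (D̃^k u)(rξ) dσ(ξ), which is `radialMoment k u r`. Since ρ D̃ = ∂_ρ ρ, one has F_k' =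
F_{k+1}, so F_k is the k-th derivative of F = F_0, and (D̃^k Θ_00)(u) is (-1)^k Y_00 F^{(k)}(1).

In polar form, ρ² L_s is a radial operator minus a sum of squares of rotation fields
(`norm_sq_mul_opL`). Rotation fields integrate to zero over spheres (`sphereIntegral_rotField`), so
the moment F_0 of L_s u is (r² - 1) F'' + 2(1 + s) r F' + s(s + 1) F. Differentiating k times gives
(r² - 1) F^{(k+2)} + 2(k + 1 + s) r F^{(k+1)} + (s + k)(s + k + 1) F^{(k)} (`radialMoment_opL_all`).
At r = 1 the first term vanishes, and at s = -k - 1 so do the other two: this is the co-mode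
equation.

The Sobolev bound is a trace estimate. The fundamental theorem of calculus on [1/2, 1] controls
F^{(k)}(1) by the L¹ norms of F^{(k)} and F^{(k+1)}, hence by derivatives of u of order at most k +
1 on a shell inside B_1. The shell avoids the origin, where D̃ is singular.

Continuity holds because D̃^k is, near S², a differential operator with smooth coefficients.
Locality of D̃ gives the support. The functional is nonzero because ρ⁻¹ e^ρ is fixed by D̃ and does
not vanish on S². -/

theorem differentiableAt_coord (i : Fin 3) (x : R3) :
    DifferentiableAt ℝ (fun x : R3 => (x i : ℂ)) x :=
  (contDiff_coord i).differentiable (by simp) x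

theorem pderiv_coord (i j : Fin 3) (x : R3) :
    pderiv i (fun y : R3 => (y j : ℂ)) x = if i = j then 1 else 0 := by
  have h : HasFDerivAt (fun y : R3 => (y j : ℂ))
      (Complex.ofRealCLM.comp (EuclideanSpace.proj (𝕜 := ℝ) j : R3 →L[ℝ] ℝ)) x :=
    (Complex.ofRealCLM.comp (EuclideanSpace.proj (𝕜 := ℝ) j : R3 →L[ℝ] ℝ)).hasFDerivAt
  rw [pderiv, h.fderiv]
  by_cases hij : i = j <;> simp [hij, eq_comm]

theorem pderiv_add {f g : R3 → ℂ} {x : R3} (hf : DifferentiableAt ℝ f x)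
    (hg : DifferentiableAt ℝ g x) (i : Fin 3) :
    pderiv i (fun y => f y + g y) x = pderiv i f x + pderiv i g x := by
  simp [pderiv, fderiv_fun_add hf hg]

theorem pderiv_sub {f g : R3 → ℂ} {x : R3} (hf : DifferentiableAt ℝ f x)
    (hg : DifferentiableAt ℝ g x) (i : Fin 3) :
    pderiv i (fun y => f y - g y) x = pderiv i f x - pderiv i g x := by
  simp [pderiv, fderiv_fun_sub hf hg]

theorem pderiv_mul {f g : R3 → ℂ} {x : R3} (hf : DifferentiableAt ℝ f x)
    (hg : DifferentiableAt ℝ g x) (i : Fin 3) :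
    pderiv i (fun y => f y * g y) x = pderiv i f x * g x + f x * pderiv i g x := by
  simp [pderiv, fderiv_fun_mul hf hg]; ring

theorem pderiv_coord_mul {g : R3 → ℂ} {x : R3} (hg : DifferentiableAt ℝ g x) (i j : Fin 3) :
    pderiv i (fun y => (y j : ℂ) * g y) x
      = (if i = j then 1 else 0) * g x + (x j : ℂ) * pderiv i g x := by
  rw [pderiv_mul (differentiableAt_coord j x) hg, pderiv_coord]

theorem pderiv_comm {u : R3 → ℂ} (hu : ContDiff ℝ ∞ u) (i j : Fin 3) :
    pderiv i (pderiv j u) = pderiv j (pderiv i u) := by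
  funext x
  have hd : DifferentiableAt ℝ (fderiv ℝ u) x :=
    (hu.fderiv_right (m := ∞) (by simp)).differentiable (by simp) x
  have h (a b : Fin 3) : pderiv a (pderiv b u) x
      = fderiv ℝ (fderiv ℝ u) x (EuclideanSpace.single a 1) (EuclideanSpace.single b 1) := by
    change fderiv ℝ (fun y => fderiv ℝ u y (EuclideanSpace.single b 1)) x _ = _
    rw [fderiv_clm_apply hd (differentiableAt_const _)]
    simp
  have hs : IsSymmSndFDerivAt ℝ u x :=
    hu.contDiffAt.isSymmSndFDerivAt (by
      rw [minSmoothness_of_isRCLikeNormedField]; exact WithTop.coe_le_coe.2 le_top)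
  rw [h, h, hs.eq]

theorem pderiv_congr {f g : R3 → ℂ} {x : R3} (h : f =ᶠ[nhds x] g) (i : Fin 3) :
    pderiv i f x = pderiv i g x := by
  rw [pderiv, pderiv, h.fderiv_eq]

theorem sum_coord_smul_single (x : R3) :
    ∑ i, x i • (EuclideanSpace.single i (1 : ℝ) : R3) = x := by
  ext j
  simp [Fin.sum_univ_three]
  fin_cases j <;> simp

theorem euler_eq_fderiv (u : R3 → ℂ) (x : R3) : euler u x = fderiv ℝ u x x := by
  calc euler u x = fderiv ℝ u x (∑ i, x i • (EuclideanSpace.single i (1 : ℝ) : R3)) := by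
        rw [map_sum]; simp [euler, pderiv]
    _ = fderiv ℝ u x x := by rw [sum_coord_smul_single]

theorem euler_congr {f g : R3 → ℂ} {x : R3} (h : f =ᶠ[nhds x] g) : euler f x = euler g x := by
  simp only [euler, pderiv_congr h]

theorem twistedD_congr {f g : R3 → ℂ} {x : R3} (h : f =ᶠ[nhds x] g) :
    twistedD f =ᶠ[nhds x] twistedD g := by
  filter_upwards [h.eventuallyEq_nhds] with y hy
  rw [twistedD, twistedD, euler_congr hy, hy.eq_of_nhds]

/-- Locality of D̃^k: used both for the support and to evaluate D̃^k on a cut-off of the explicit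
function ρ⁻¹ e^ρ. -/
theorem twistedD_iterate_congr {f g : R3 → ℂ} {x : R3} (h : f =ᶠ[nhds x] g) (k : ℕ) :
    twistedD^[k] f =ᶠ[nhds x] twistedD^[k] g := by
  induction k with
  | zero => exact h
  | succ k ih => simpa only [Function.iterate_succ_apply'] using twistedD_congr ih

/-! ### Functions smooth away from the origin -/

theorem contDiffOn_pderiv {g : R3 → ℂ} (hg : ContDiffOn ℝ ∞ g {0}ᶜ) (i : Fin 3) :
    ContDiffOn ℝ ∞ (pderiv i g) {0}ᶜ :=
  (hg.fderiv_of_isOpen isOpen_compl_singleton (m := ∞) (by simp)).clm_apply contDiffOn_const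

theorem contDiffOn_euler {g : R3 → ℂ} (hg : ContDiffOn ℝ ∞ g {0}ᶜ) :
    ContDiffOn ℝ ∞ (euler g) {0}ᶜ :=
  ContDiffOn.sum fun i _ => (contDiff_coord i).contDiffOn.mul (contDiffOn_pderiv hg i)

theorem contDiffOn_inv_norm : ContDiffOn ℝ ∞ (fun x : R3 => ((‖x‖⁻¹ : ℝ) : ℂ)) {0}ᶜ :=
  Complex.ofRealCLM.contDiff.comp_contDiffOn
    ((contDiffOn_id.norm ℝ fun _ hx => hx).inv fun _ hx => norm_ne_zero_iff.2 hx)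

theorem contDiffOn_twistedD {g : R3 → ℂ} (hg : ContDiffOn ℝ ∞ g {0}ᶜ) :
    ContDiffOn ℝ ∞ (twistedD g) {0}ᶜ :=
  contDiffOn_inv_norm.mul ((contDiffOn_euler hg).add hg)

theorem contDiffOn_twistedD_iterate {g : R3 → ℂ} (hg : ContDiffOn ℝ ∞ g {0}ᶜ) (k : ℕ) :
    ContDiffOn ℝ ∞ (twistedD^[k] g) {0}ᶜ := by
  induction k with
  | zero => exact hg
  | succ k ih => rw [Function.iterate_succ_apply']; exact contDiffOn_twistedD ih

theorem differentiableAt_of_contDiffOn {g : R3 → ℂ} (hg : ContDiffOn ℝ ∞ g {0}ᶜ) {x : R3}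
    (hx : x ≠ 0) : DifferentiableAt ℝ g x :=
  (hg.contDiffAt (isOpen_compl_singleton.mem_nhds hx)).differentiableAt (by simp)

/-! ### Rotation fields and the operator in polar form -/

/-- The rotation field `x_i ∂_j - x_j ∂_i`. -/
def rotField (i j : Fin 3) (u : R3 → ℂ) (x : R3) : ℂ :=
  (x i : ℂ) * pderiv j u x - (x j : ℂ) * pderiv i u x

theorem contDiff_rotField {u : R3 → ℂ} (hu : ContDiff ℝ ∞ u) (i j : Fin 3) :
    ContDiff ℝ ∞ (rotField i j u) :=
  ((contDiff_coord i).mul (contDiff_pderiv hu j)).sub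
    ((contDiff_coord j).mul (contDiff_pderiv hu i))

theorem pderiv_rotField {u : R3 → ℂ} (hu : ContDiff ℝ ∞ u) (i j l : Fin 3) (x : R3) :
    pderiv l (rotField i j u) x =
      ((if l = i then 1 else 0) * pderiv j u x + (x i : ℂ) * pderiv l (pderiv j u) x) -
      ((if l = j then 1 else 0) * pderiv i u x + (x j : ℂ) * pderiv l (pderiv i u) x) := by
  have hp (a : Fin 3) : DifferentiableAt ℝ (pderiv a u) x :=
    (contDiff_pderiv hu a).differentiable (by simp) x
  rw [← pderiv_coord_mul (hp j), ← pderiv_coord_mul (hp i)]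
  exact pderiv_sub ((differentiableAt_coord i x).mul (hp j))
    ((differentiableAt_coord j x).mul (hp i)) l

theorem euler_eq_three (u : R3 → ℂ) : euler u = fun x : R3 =>
    (x 0 : ℂ) * pderiv 0 u x + (x 1 : ℂ) * pderiv 1 u x + (x 2 : ℂ) * pderiv 2 u x := by
  funext x; simp [euler, Fin.sum_univ_three]

theorem pderiv_euler {u : R3 → ℂ} (hu : ContDiff ℝ ∞ u) (l : Fin 3) (x : R3) :
    pderiv l (euler u) x = pderiv l u x + euler (pderiv l u) x := by
  have hp (a : Fin 3) : DifferentiableAt ℝ (pderiv a u) x :=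
    (contDiff_pderiv hu a).differentiable (by simp) x
  have hc (a : Fin 3) : DifferentiableAt ℝ (fun y : R3 => (y a : ℂ) * pderiv a u y) x :=
    (differentiableAt_coord a x).mul (hp a)
  rw [euler_eq_three, pderiv_add ((hc 0).fun_add (hc 1)) (hc 2), pderiv_add (hc 0) (hc 1),
    pderiv_coord_mul (hp 0), pderiv_coord_mul (hp 1), pderiv_coord_mul (hp 2), euler_eq_three,
    pderiv_comm hu l 0, pderiv_comm hu l 1, pderiv_comm hu l 2]
  fin_cases l <;> simp <;> ring

theorem norm_sq_eq_coord (x : R3) :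
    ((‖x‖ : ℝ) : ℂ) ^ 2 = (x 0 : ℂ) ^ 2 + (x 1 : ℂ) ^ 2 + (x 2 : ℂ) ^ 2 := by
  have h := EuclideanSpace.norm_sq_eq x
  simp only [Fin.sum_univ_three, Real.norm_eq_abs, sq_abs] at h
  exact_mod_cast h

/-- Decomposition of `ρ² L_s` into radial derivatives and squares of rotation fields. -/
theorem norm_sq_mul_opL {u : R3 → ℂ} (hu : ContDiff ℝ ∞ u) (s : ℂ) (x : R3) :
    ((‖x‖ : ℝ) : ℂ) ^ 2 * opL s u x =
      -(euler (euler u) x + euler u x + (rotField 0 1 (rotField 0 1 u) x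
        + rotField 0 2 (rotField 0 2 u) x + rotField 1 2 (rotField 1 2 u) x))
      + ((‖x‖ : ℝ) : ℂ) ^ 2 * (euler (euler u) x + (3 + 2 * s) * euler u x
        + (2 + 3 * s + s ^ 2) * u x) := by
  have hee : euler (euler u) x = ∑ i, (x i : ℂ) * pderiv i (euler u) x := rfl
  have hr (i j : Fin 3) : rotField i j (rotField i j u) x
    = (x i : ℂ) * pderiv j (rotField i j u) x - (x j : ℂ) * pderiv i (rotField i j u) x := rfl
  rw [hee]
  simp only [hr, pderiv_euler hu, pderiv_rotField hu]
  -- What remains is a polynomial identity in the coordinates and the partial derivatives of `u`,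
  -- once mixed partials are put in one order.
  simp only [opL, opL0, opP, euler_eq_three, Fin.sum_univ_three, norm_sq_eq_coord, pderiv_comm hu 1 0, pderiv_comm hu 2 0,
    pderiv_comm hu 2 1]
  simp
  ring

/-! ### Spherical integrals -/

/-- The unit sphere, as a type. -/
abbrev S2 : Type := Metric.sphere (0 : R3) 1

/-- The standard surface measure of the unit sphere. -/
abbrev surf : Measure S2 := (volume : Measure R3).toSphere

/-- The integral of `ξ ↦ g (r ξ)` over the unit sphere. -/
def sphereIntegral (r : ℝ) (g : R3 → ℂ) : ℂ := ∫ ξ : S2, g (r • (ξ : R3)) ∂surf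

theorem smul_sphere_ne_zero {r : ℝ} (hr : 0 < r) (ξ : S2) : r • (ξ : R3) ≠ 0 :=
  smul_ne_zero hr.ne' (ne_zero_of_mem_unit_sphere ξ)

theorem norm_smul_sphere {r : ℝ} (hr : 0 < r) (ξ : S2) : ‖r • (ξ : R3)‖ = r := by
  rw [norm_smul, norm_eq_of_mem_sphere ξ, mul_one, Real.norm_of_nonneg hr.le]

theorem continuous_comp_smul_sphere {E : Type*} [TopologicalSpace E] {g : R3 → E}
    (hg : ContinuousOn g {0}ᶜ) {r : ℝ} (hr : 0 < r) : Continuous fun ξ : S2 => g (r • (ξ : R3)) :=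
  hg.comp_continuous (by fun_prop) fun ξ => smul_sphere_ne_zero hr ξ

theorem integrable_comp_smul_sphere {E : Type*} [NormedAddCommGroup E] {g : R3 → E}
    (hg : ContinuousOn g {0}ᶜ) {r : ℝ} (hr : 0 < r) :
    Integrable (fun ξ : S2 => g (r • (ξ : R3))) surf :=
  (continuous_comp_smul_sphere hg hr).integrable_of_hasCompactSupport
    (HasCompactSupport.of_compactSpace _)

theorem sphereIntegral_add {f g : R3 → ℂ} (hf : ContinuousOn f {0}ᶜ) (hg : ContinuousOn g {0}ᶜ)
    {r : ℝ} (hr : 0 < r) :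
    sphereIntegral r (fun x => f x + g x) = sphereIntegral r f + sphereIntegral r g :=
  integral_add (integrable_comp_smul_sphere hf hr) (integrable_comp_smul_sphere hg hr)

theorem sphereIntegral_const_mul (c : ℂ) (g : R3 → ℂ) (r : ℝ) :
    sphereIntegral r (fun x => c * g x) = c * sphereIntegral r g :=
  integral_const_mul c _

theorem sphereIntegral_congr {f g : R3 → ℂ} {r : ℝ} (hr : 0 < r)
    (h : ∀ x : R3, ‖x‖ = r → f x = g x) : sphereIntegral r f = sphereIntegral r g :=
  integral_congr_ae (.of_forall fun ξ => h _ (norm_smul_sphere hr ξ))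

/-- A closed shell is compact and misses the origin. This supplies the dominating constants for
differentiation under the integral and bounds the coefficients of D̃^k. -/
theorem exists_bound_on_shell {E : Type*} [NormedAddCommGroup E] {g : R3 → E}
    (hg : ContinuousOn g {0}ᶜ) {a : ℝ} (ha : 0 < a) (b : ℝ) :
    ∃ C, 0 ≤ C ∧ ∀ x : R3, a ≤ ‖x‖ → ‖x‖ ≤ b → ‖g x‖ ≤ C := by
  have hK : IsCompact (Metric.closedBall (0 : R3) b \ Metric.ball 0 a) :=
    (isCompact_closedBall _ _).diff Metric.isOpen_ball
  obtain ⟨C, hC⟩ := hK.exists_bound_of_continuousOn (hg.mono fun x hx h0 => hx.2 (by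
    rw [Set.mem_singleton_iff] at h0; simpa [h0] using ha))
  exact ⟨max C 0, le_max_right _ _, fun x h1 h2 =>
    (hC x ⟨by simpa using h2, by simpa using h1⟩).trans (le_max_left _ _)⟩

/-- Differentiation of spherical integrals in the radius. -/
theorem hasDerivAt_sphereIntegral {g : R3 → ℂ} (hg : ContDiffOn ℝ ∞ g {0}ᶜ) {r : ℝ} (hr : 0 < r) :
    HasDerivAt (fun t : ℝ => sphereIntegral t g) ((r : ℂ)⁻¹ * sphereIntegral r (euler g)) r := by
  have hE := (contDiffOn_euler hg).continuousOn
  -- Radii within r/2 of r stay in [r/2, 2r], away from the possible singularity of `g` at the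
  -- origin.
  obtain ⟨C, hC0, hC⟩ := exists_bound_on_shell hE (half_pos hr) (2 * r)
  have hpos {t : ℝ} (ht : t ∈ Metric.ball r (r / 2)) : r / 2 < t ∧ t < 2 * r := by
    rw [Real.ball_eq_Ioo] at ht; constructor <;> linarith [ht.1, ht.2]
  have key := (hasDerivAt_integral_of_dominated_loc_of_deriv_le (μ := surf)
    (F := fun t ξ => g (t • (ξ : R3))) (F' := fun t ξ => (t : ℂ)⁻¹ * euler g (t • (ξ : R3)))
    (x₀ := r) (s := Metric.ball r (r / 2)) (bound := fun _ => (r / 2)⁻¹ * C)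
    (Metric.ball_mem_nhds r (half_pos hr)) ?_ (integrable_comp_smul_sphere hg.continuousOn hr) ?_ ?_
    (integrable_const _) ?_).2
  · simpa only [sphereIntegral, integral_const_mul] using key
  · filter_upwards [lt_mem_nhds hr] with t ht
    exact (integrable_comp_smul_sphere hg.continuousOn ht).aestronglyMeasurable
  · exact ((integrable_comp_smul_sphere hE hr).const_mul _).aestronglyMeasurable
  · refine .of_forall fun ξ t ht => ?_
    obtain ⟨h1, h2⟩ := hpos ht
    have ht0 : 0 < t := (half_pos hr).trans h1
    rw [norm_mul, norm_inv, Complex.norm_real, Real.norm_of_nonneg ht0.le]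
    gcongr
    exact hC _ (by rw [norm_smul_sphere ht0]; exact h1.le) (by rw [norm_smul_sphere ht0]; exact h2.le)
  · refine .of_forall fun ξ t ht => ?_
    have ht0 : 0 < t := (half_pos hr).trans (hpos ht).1
    have h1 := (differentiableAt_of_contDiffOn hg (smul_sphere_ne_zero ht0 ξ)).hasFDerivAt
    have h2 : HasDerivAt (fun t : ℝ => t • (ξ : R3)) (ξ : R3) t := by
      simpa using (hasDerivAt_id t).smul_const (ξ : R3)
    refine (h1.comp_hasDerivAt t h2).congr_deriv ?_
    rw [euler_eq_fderiv, map_smul, Complex.real_smul, ← mul_assoc,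
      inv_mul_cancel₀ (by exact_mod_cast ht0.ne'), one_mul]

/-- The spherical mean of `ρ D̃^k f`, up to normalization. -/
def radialMoment (k : ℕ) (f : R3 → ℂ) (r : ℝ) : ℂ := r * sphereIntegral r (twistedD^[k] f)

theorem mul_sphereIntegral_twistedD {g : R3 → ℂ} (hg : ContDiffOn ℝ ∞ g {0}ᶜ) {r : ℝ}
    (hr : 0 < r) :
    (r : ℂ) * sphereIntegral r (twistedD g) = sphereIntegral r (euler g) + sphereIntegral r g := by
  rw [← sphereIntegral_const_mul,
    ← sphereIntegral_add (contDiffOn_euler hg).continuousOn hg.continuousOn hr]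
  refine sphereIntegral_congr hr fun x hx => ?_
  rw [twistedD, hx, Complex.ofReal_inv, ← mul_assoc,
    mul_inv_cancel₀ (by exact_mod_cast hr.ne'), one_mul]

/-- This is ρ D̃ = ∂_ρ ρ integrated over the sphere: the twist by ρ makes the moments successive
derivatives of one function of r. -/
theorem hasDerivAt_radialMoment {f : R3 → ℂ} (hf : ContDiffOn ℝ ∞ f {0}ᶜ) (k : ℕ) {r : ℝ}
    (hr : 0 < r) : HasDerivAt (radialMoment k f) (radialMoment (k + 1) f r) r := by
  have hg := contDiffOn_twistedD_iterate hf k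
  have h : HasDerivAt (radialMoment k f) _ r :=
    ((hasDerivAt_id (r : ℂ)).comp_ofReal).mul (hasDerivAt_sphereIntegral hg hr)
  convert h using 1
  rw [radialMoment, Function.iterate_succ_apply', mul_sphereIntegral_twistedD hg hr]
  have : (r : ℂ) ≠ 0 := by exact_mod_cast hr.ne'
  simp
  field_simp
  ring

/-! ### Rotation invariance -/

open scoped Pointwise in
-- The surface measure of s is, up to a constant, the volume of the cone (0,1)·s, and a linear
-- isometry maps cones to cones and preserves volume.
theorem measurePreserving_sphere_of_isometry (R : R3 ≃ₗᵢ[ℝ] R3) {φ : S2 → S2} (hφ : Continuous φ)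
    (h : ∀ ξ, (φ ξ : R3) = R ξ) : MeasurePreserving φ surf surf := by
  refine ⟨hφ.measurable, Measure.ext fun s hs => ?_⟩
  rw [Measure.map_apply hφ.measurable hs, Measure.toSphere_apply' _ (hφ.measurable hs),
    Measure.toSphere_apply' _ hs]
  congr 1
  have hR := (R.measurePreserving).measure_preimage_equiv (f := R.toMeasurableEquiv)
    (Set.Ioo (0 : ℝ) 1 • ((↑) '' s : Set R3))
  rw [← hR]
  congr 1
  ext x
  simp only [Set.mem_preimage, Set.mem_smul]
  constructor
  · rintro ⟨t, ht, _, ⟨ξ, hξ, rfl⟩, rfl⟩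
    exact ⟨t, ht, _, ⟨φ ξ, hξ, rfl⟩, by rw [h]; simp⟩
  · rintro ⟨t, ht, _, ⟨ξ, hξ, rfl⟩, hx⟩
    have hn : R.symm (ξ : R3) ∈ Metric.sphere (0 : R3) 1 := by simp
    refine ⟨t, ht, _, ⟨⟨R.symm ξ, hn⟩, ?_, rfl⟩, ?_⟩
    · have : φ ⟨R.symm ξ, hn⟩ = ξ := Subtype.ext (by rw [h]; simp)
      rwa [Set.mem_preimage, this]
    · apply R.injective
      change t • (ξ : R3) = R x at hx
      rw [← hx]; simp

theorem sphereIntegral_comp_isometry (R : R3 ≃ₗᵢ[ℝ] R3) (g : R3 → ℂ) (r : ℝ) :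
    sphereIntegral r (fun x => g (R x)) = sphereIntegral r g := by
  let φ : S2 ≃ₜ S2 :=
    { toFun := fun ξ => ⟨R ξ, by simp⟩
      invFun := fun ξ => ⟨R.symm ξ, by simp⟩
      left_inv := fun ξ => by simp
      right_inv := fun ξ => by simp
      continuous_toFun := by fun_prop
      continuous_invFun := by fun_prop }
  have h := (measurePreserving_sphere_of_isometry R φ.continuous fun _ => rfl).integral_comp
    φ.measurableEmbedding (fun ξ : S2 => g (r • (ξ : R3)))
  rw [sphereIntegral, sphereIntegral, ← h]
  refine integral_congr_ae (.of_forall fun ξ => ?_)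
  change g (R (r • (ξ : R3))) = g (r • R ξ)
  rw [map_smul]

/-- The rotation by the angle `t` in the plane of the coordinates `i ≠ j`. -/
def rotVec (i j : Fin 3) (t : ℝ) (x : R3) : R3 :=
  x + ((Real.cos t - 1) * x i - Real.sin t * x j) • EuclideanSpace.single i (1 : ℝ)
    + (Real.sin t * x i + (Real.cos t - 1) * x j) • EuclideanSpace.single j (1 : ℝ)

theorem norm_rotVec {i j : Fin 3} (hij : i ≠ j) (t : ℝ) (x : R3) : ‖rotVec i j t x‖ = ‖x‖ := by
  rw [← sq_eq_sq₀ (norm_nonneg _) (norm_nonneg _), EuclideanSpace.norm_sq_eq,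
    EuclideanSpace.norm_sq_eq]
  simp only [rotVec, Fin.sum_univ_three, Real.norm_eq_abs, sq_abs]
  have h := Real.sin_sq_add_cos_sq t
  fin_cases i <;> fin_cases j <;> simp at hij ⊢ <;>
    first
    | linear_combination (x 0 ^ 2 + x 1 ^ 2) * h
    | linear_combination (x 0 ^ 2 + x 2 ^ 2) * h
    | linear_combination (x 1 ^ 2 + x 2 ^ 2) * h

/-- The rotation `rotVec i j t` as a linear isometry. -/
def rotIsometry {i j : Fin 3} (hij : i ≠ j) (t : ℝ) : R3 ≃ₗᵢ[ℝ] R3 :=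
  LinearIsometry.toLinearIsometryEquiv
    { toFun := rotVec i j t
      map_add' := fun x y => by simp only [rotVec, PiLp.add_apply]; module
      map_smul' := fun c x => by
        simp only [rotVec, PiLp.smul_apply, smul_eq_mul, RingHom.id_apply]; module
      norm_map' := norm_rotVec hij t } rfl

theorem rotVec_zero (i j : Fin 3) (x : R3) : rotVec i j 0 x = x := by simp [rotVec]

theorem hasDerivAt_rotVec {i j : Fin 3} (hij : i ≠ j) (t : ℝ) (x : R3) :
    HasDerivAt (fun t => rotVec i j t x)
      (rotVec i j t x i • EuclideanSpace.single j (1 : ℝ)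
        - rotVec i j t x j • EuclideanSpace.single i (1 : ℝ)) t := by
  have hi : rotVec i j t x i = Real.cos t * x i - Real.sin t * x j := by
    simp [rotVec, hij]; ring
  have hj : rotVec i j t x j = Real.sin t * x i + Real.cos t * x j := by
    simp [rotVec, hij.symm]; ring
  rw [hi, hj]
  have hc := (Real.hasDerivAt_cos t).sub_const 1
  have hs := Real.hasDerivAt_sin t
  have h : HasDerivAt (fun t => rotVec i j t x) _ t := (((hc.mul_const (x i)).sub (hs.mul_const (x j))).smul_const
      (EuclideanSpace.single i (1 : ℝ) : R3)).const_add x |>.add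
    (((hs.mul_const (x i)).add (hc.mul_const (x j))).smul_const
      (EuclideanSpace.single j (1 : ℝ) : R3))
  refine h.congr_deriv ?_
  module

/-- Rotation fields have vanishing integral over every sphere. -/
theorem sphereIntegral_rotField {g : R3 → ℂ} (hg : ContDiff ℝ ∞ g) {i j : Fin 3} (hij : i ≠ j)
    {r : ℝ} (hr : 0 < r) : sphereIntegral r (rotField i j g) = 0 := by
  have hX := (contDiff_rotField hg i j).continuous
  obtain ⟨C, hC0, hC⟩ := exists_bound_on_shell hX.continuousOn hr r
  have hcont (t : ℝ) : Continuous (rotVec i j t) := (rotIsometry hij t).continuous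
  -- The integral of `g` over the rotated sphere does not depend on the angle t, while its
  -- derivative at t = 0 is the integral of the rotation field applied to `g`.
  have key := (hasDerivAt_integral_of_dominated_loc_of_deriv_le (μ := surf)
    (F := fun t ξ => g (rotVec i j t (r • (ξ : R3))))
    (F' := fun t ξ => rotField i j g (rotVec i j t (r • (ξ : R3))))
    (x₀ := 0) (s := Set.univ) (bound := fun _ => C) Filter.univ_mem ?_ ?_ ?_ ?_
    (integrable_const _) ?_).2
  · have h0 : (fun t : ℝ => ∫ ξ : S2, g (rotVec i j t (r • (ξ : R3))) ∂surf)
        = fun _ => sphereIntegral r g :=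
      funext fun t => sphereIntegral_comp_isometry (rotIsometry hij t) g r
    rw [h0] at key
    simpa only [rotVec_zero, sphereIntegral] using key.unique (hasDerivAt_const _ _)
  · exact .of_forall fun t => (integrable_comp_smul_sphere
      (hg.continuous.comp (hcont t)).continuousOn hr).aestronglyMeasurable
  · exact integrable_comp_smul_sphere (hg.continuous.comp (hcont 0)).continuousOn hr
  · exact (integrable_comp_smul_sphere
      (hX.comp (hcont 0)).continuousOn hr).aestronglyMeasurable
  · refine .of_forall fun ξ t _ => ?_
    have : ‖rotVec i j t (r • (ξ : R3))‖ = r := by rw [norm_rotVec hij, norm_smul_sphere hr]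
    exact hC _ this.ge this.le
  · refine .of_forall fun ξ t _ => ?_
    have h1 := (hg.differentiable (by simp) (rotVec i j t (r • (ξ : R3)))).hasFDerivAt
    refine (h1.comp_hasDerivAt t (hasDerivAt_rotVec hij t (r • (ξ : R3)))).congr_deriv ?_
    simp [rotField, pderiv]

/-! ### The radial equation -/

/-- The rotation terms in `norm_sq_mul_opL` integrate to zero. The remaining integrals of u, ρ∂_ρ u
and (ρ∂_ρ)² u are rewritten through F, F' and F''. -/
theorem radialMoment_opL {u : R3 → ℂ} (hu : ContDiff ℝ ∞ u) (s : ℂ) {r : ℝ} (hr : 0 < r) :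
    radialMoment 0 (opL s u) r = ((r : ℂ) ^ 2 - 1) * radialMoment 2 u r
      + 2 * (1 + s) * (r * radialMoment 1 u r) + s * (s + 1) * radialMoment 0 u r := by
  have hr0 : (r : ℂ) ≠ 0 := by exact_mod_cast hr.ne'
  have hu' := hu.contDiffOn (s := {0}ᶜ)
  have hE := contDiff_euler hu
  have hEE := contDiff_euler hE
  have h1 : radialMoment 1 u r = sphereIntegral r (euler u) + sphereIntegral r u :=
    mul_sphereIntegral_twistedD hu' hr
  -- Both sides come from the derivative of F_1 = ∫ (ρ∂_ρ u + u), computed in two ways.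
  have h2 : (r : ℂ) * radialMoment 2 u r
      = sphereIntegral r (euler (euler u)) + sphereIntegral r (euler u) := by
    have hd := hasDerivAt_radialMoment hu' 1 hr
    have hd' : HasDerivAt (radialMoment 1 u) ((r : ℂ)⁻¹ * sphereIntegral r (euler (euler u))
        + (r : ℂ)⁻¹ * sphereIntegral r (euler u)) r := by
      refine ((hasDerivAt_sphereIntegral hE.contDiffOn hr).add
        (hasDerivAt_sphereIntegral hu' hr)).congr_of_eventuallyEq ?_
      filter_upwards [lt_mem_nhds hr] with t ht
      exact mul_sphereIntegral_twistedD hu' ht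
    rw [hd.unique hd']
    field_simp
  have hrot {i j : Fin 3} (hij : i ≠ j) : sphereIntegral r (rotField i j (rotField i j u)) = 0 :=
    sphereIntegral_rotField (contDiff_rotField hu i j) hij hr
  have key : (r : ℂ) ^ 2 * sphereIntegral r (opL s u) =
      ((r : ℂ) ^ 2 - 1) * sphereIntegral r (euler (euler u))
      + ((3 + 2 * s) * (r : ℂ) ^ 2 - 1) * sphereIntegral r (euler u)
      + (2 + 3 * s + s ^ 2) * (r : ℂ) ^ 2 * sphereIntegral r u := by
    have hc {a : ℂ} {f : R3 → ℂ} (hf : ContDiff ℝ ∞ f) :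
        ContinuousOn (fun x => a * f x) {0}ᶜ :=
      (continuous_const.mul hf.continuous).continuousOn
    have hR {i j : Fin 3} := contDiff_rotField (contDiff_rotField hu i j) i j
    rw [← sphereIntegral_const_mul]
    have e : sphereIntegral r (fun x => (r : ℂ) ^ 2 * opL s u x) = sphereIntegral r (fun x =>
        (((((r : ℂ) ^ 2 - 1) * euler (euler u) x
          + ((3 + 2 * s) * (r : ℂ) ^ 2 - 1) * euler u x)
          + (2 + 3 * s + s ^ 2) * (r : ℂ) ^ 2 * u x)
          + (-1) * rotField 0 1 (rotField 0 1 u) x)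
          + ((-1) * rotField 0 2 (rotField 0 2 u) x
          + (-1) * rotField 1 2 (rotField 1 2 u) x)) := by
      refine sphereIntegral_congr hr fun x hx => ?_
      rw [← hx, norm_sq_mul_opL hu]
      ring
    rw [e, sphereIntegral_add ((((hc hEE).fun_add (hc hE)).fun_add (hc hu)).fun_add (hc hR))
        ((hc hR).fun_add (hc hR)) hr,
      sphereIntegral_add (hc hR) (hc hR) hr,
      sphereIntegral_add (((hc hEE).fun_add (hc hE)).fun_add (hc hu)) (hc hR) hr,
      sphereIntegral_add ((hc hEE).fun_add (hc hE)) (hc hu) hr,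
      sphereIntegral_add (hc hEE) (hc hE) hr]
    simp only [sphereIntegral_const_mul, hrot (show (0 : Fin 3) ≠ 1 by decide),
      hrot (show (0 : Fin 3) ≠ 2 by decide), hrot (show (1 : Fin 3) ≠ 2 by decide)]
    ring
  apply mul_left_cancel₀ hr0
  have e0 : radialMoment 0 (opL s u) r = r * sphereIntegral r (opL s u) := rfl
  have e1 : radialMoment 0 u r = r * sphereIntegral r u := rfl
  rw [e0, e1, h1]
  linear_combination key - ((r : ℂ) ^ 2 - 1) * h2

/-- The k-th derivative in r of the equation for k = 0; each induction step differentiates once. The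
last coefficient equals (s + k)(s + k + 1). -/
theorem radialMoment_opL_all {u : R3 → ℂ} (hu : ContDiff ℝ ∞ u) (s : ℂ) (k : ℕ) :
    ∀ {r : ℝ}, 0 < r → radialMoment k (opL s u) r = ((r : ℂ) ^ 2 - 1) * radialMoment (k + 2) u r
      + 2 * (k + 1 + s) * (r * radialMoment (k + 1) u r)
      + (k * (k - 1) + 2 * (1 + s) * k + s * (s + 1)) * radialMoment k u r := by
  induction k with
  | zero => intro r hr; rw [radialMoment_opL hu s hr]; push_cast; ring
  | succ k ih =>
    intro r hr
    have hu' := hu.contDiffOn (s := {0}ᶜ)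
    have hd := hasDerivAt_radialMoment ((contDiff_opL s hu).contDiffOn (s := {0}ᶜ)) k hr
    have hid : HasDerivAt (fun t : ℝ => (t : ℂ)) 1 r := (hasDerivAt_id (r : ℂ)).comp_ofReal
    have hd' := ((((hid.pow 2).sub_const 1).mul (hasDerivAt_radialMoment hu' (k + 2) hr)).add
      ((hid.mul (hasDerivAt_radialMoment hu' (k + 1) hr)).const_mul (2 * (k + 1 + s)))).add
      ((hasDerivAt_radialMoment hu' k hr).const_mul
        (k * (k - 1) + 2 * (1 + s) * k + s * (s + 1)))
    rw [hd.unique (hd'.congr_of_eventuallyEq ?_)]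
    · push_cast; simp; ring
    · filter_upwards [lt_mem_nhds hr] with t ht
      rw [ih ht]; rfl

theorem Theta00_eq_sphereIntegral (f : R3 → ℂ) : Theta00 f = Y00 * sphereIntegral 1 f := by
  simp only [Theta00, sphereIntegral, integral_const_mul, one_smul]

theorem twistedTheta_eq_radialMoment (k : ℕ) (f : R3 → ℂ) :
    twistedTheta k f = (-1) ^ k * (Y00 * radialMoment k f 1) := by
  rw [twistedTheta, Theta00_eq_sphereIntegral, radialMoment]; simp

theorem twistedTheta_opL {u : R3 → ℂ} (hu : ContDiff ℝ ∞ u) (k : ℕ) :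
    twistedTheta k (opL (-(k : ℂ) - 1) u) = 0 := by
  rw [twistedTheta_eq_radialMoment, radialMoment_opL_all hu _ k one_pos]
  push_cast
  ring

/-! ### Differential operators with coefficients smooth away from the origin -/

theorem contDiff_pderiv_iterate {u : R3 → ℂ} (hu : ContDiff ℝ ∞ u) (i : Fin 3) (n : ℕ) :
    ContDiff ℝ ∞ ((pderiv i)^[n] u) := by
  induction n with
  | zero => exact hu
  | succ n ih => rw [Function.iterate_succ_apply']; exact contDiff_pderiv ih i

theorem contDiff_multiDeriv {u : R3 → ℂ} (hu : ContDiff ℝ ∞ u) (α : Fin 3 → ℕ) :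
    ContDiff ℝ ∞ (multiDeriv α u) :=
  contDiff_pderiv_iterate (contDiff_pderiv_iterate (contDiff_pderiv_iterate hu _ _) _ _) _ _

theorem pderiv_iterate_comm {u : R3 → ℂ} (hu : ContDiff ℝ ∞ u) (i j : Fin 3) (n : ℕ) :
    pderiv i ((pderiv j)^[n] u) = (pderiv j)^[n] (pderiv i u) := by
  induction n with
  | zero => rfl
  | succ n ih =>
    rw [Function.iterate_succ_apply', Function.iterate_succ_apply',
      pderiv_comm (contDiff_pderiv_iterate hu j n), ih]

theorem pderiv_multiDeriv {u : R3 → ℂ} (hu : ContDiff ℝ ∞ u) (i : Fin 3) (α : Fin 3 → ℕ) :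
    pderiv i (multiDeriv α u) = multiDeriv (α + Pi.single i 1) u := by
  have h2 := contDiff_pderiv_iterate hu 2 (α 2)
  have h1 := contDiff_pderiv_iterate h2 1 (α 1)
  unfold multiDeriv
  fin_cases i
  · simp [Function.iterate_succ_apply']
  · simp [pderiv_iterate_comm h1, Function.iterate_succ_apply']
  · simp [pderiv_iterate_comm h1, pderiv_iterate_comm h2, Function.iterate_succ_apply']

/-- The multi-indices of order at most `n`. -/
def multiIndices (n : ℕ) : Finset (Fin 3 → ℕ) :=
  (Finset.range (n + 1)).biUnion fun j => Finset.piAntidiag Finset.univ j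

theorem mem_multiIndices {n : ℕ} {α : Fin 3 → ℕ} : α ∈ multiIndices n ↔ ∑ i, α i ≤ n := by
  simp [multiIndices]

/-- `A` is a linear differential operator of order at most `n`, with coefficients that are smooth
away from the origin. -/
def IsDiffOp (n : ℕ) (A : (R3 → ℂ) → R3 → ℂ) : Prop :=
  ∃ a : (Fin 3 → ℕ) → R3 → ℂ, (∀ α, ContDiffOn ℝ ∞ (a α) {0}ᶜ) ∧
    ∀ f, ContDiff ℝ ∞ f → ∀ x ≠ 0, A f x = ∑ α ∈ multiIndices n, a α x * multiDeriv α f x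

theorem IsDiffOp.congr {n : ℕ} {A B : (R3 → ℂ) → R3 → ℂ} (hA : IsDiffOp n A)
    (h : ∀ f, ContDiff ℝ ∞ f → ∀ x ≠ 0, B f x = A f x) : IsDiffOp n B := by
  obtain ⟨a, ha, hA⟩ := hA
  exact ⟨a, ha, fun f hf x hx => (h f hf x hx).trans (hA f hf x hx)⟩

theorem isDiffOp_monomial {n : ℕ} {α : Fin 3 → ℕ} (hα : α ∈ multiIndices n) {a : R3 → ℂ}
    (ha : ContDiffOn ℝ ∞ a {0}ᶜ) : IsDiffOp n fun f x => a x * multiDeriv α f x := by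
  classical
  refine ⟨fun β x => if β = α then a x else 0, fun β => ?_, fun f _ x _ => ?_⟩
  · by_cases h : β = α
    · simpa [h] using ha
    · simpa [h] using contDiffOn_const
  · simp [ite_mul, hα]

theorem IsDiffOp.add {n : ℕ} {A B : (R3 → ℂ) → R3 → ℂ} (hA : IsDiffOp n A) (hB : IsDiffOp n B) :
    IsDiffOp n fun f x => A f x + B f x := by
  obtain ⟨a, ha, hA⟩ := hA
  obtain ⟨b, hb, hB⟩ := hB
  refine ⟨fun α x => a α x + b α x, fun α => (ha α).add (hb α), fun f hf x hx => ?_⟩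
  simp only [hA f hf x hx, hB f hf x hx, add_mul, Finset.sum_add_distrib]

theorem IsDiffOp.sum {n : ℕ} {ι : Type*} (s : Finset ι) {A : ι → (R3 → ℂ) → R3 → ℂ}
    (hA : ∀ i ∈ s, IsDiffOp n (A i)) : IsDiffOp n fun f x => ∑ i ∈ s, A i f x := by
  classical
  induction s using Finset.induction_on with
  | empty => exact ⟨fun _ _ => 0, fun _ => contDiffOn_const, by simp⟩
  | insert i s hi ih =>
    refine ((hA i (Finset.mem_insert_self i s)).add
      (ih fun j hj => hA j (Finset.mem_insert_of_mem hj))).congr fun f _ x _ => ?_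
    rw [Finset.sum_insert hi]

theorem IsDiffOp.coeff_mul {n : ℕ} {A : (R3 → ℂ) → R3 → ℂ} (hA : IsDiffOp n A) {b : R3 → ℂ}
    (hb : ContDiffOn ℝ ∞ b {0}ᶜ) : IsDiffOp n fun f x => b x * A f x := by
  obtain ⟨a, ha, hA⟩ := hA
  refine ⟨fun α x => b x * a α x, fun α => hb.mul (ha α), fun f hf x hx => ?_⟩
  simp only [hA f hf x hx, Finset.mul_sum, mul_assoc]

theorem IsDiffOp.mono {m n : ℕ} (hmn : m ≤ n) {A : (R3 → ℂ) → R3 → ℂ} (hA : IsDiffOp m A) :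
    IsDiffOp n A := by
  obtain ⟨a, ha, hA⟩ := hA
  exact (IsDiffOp.sum (multiIndices m) fun α hα => isDiffOp_monomial
    (mem_multiIndices.2 ((mem_multiIndices.1 hα).trans hmn)) (ha α)).congr hA

/-- The product rule: the derivative falls on the coefficient, keeping the multi-index, or on ∂^α f,
raising it by one. The formula for `A f` holds on an open set, so it can be differentiated. -/
theorem IsDiffOp.pderiv {n : ℕ} {A : (R3 → ℂ) → R3 → ℂ} (hA : IsDiffOp n A) (i : Fin 3) :
    IsDiffOp (n + 1) fun f => pderiv i (A f) := by
  obtain ⟨a, ha, hA⟩ := hA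
  refine (IsDiffOp.sum (multiIndices n) fun α hα =>
    (isDiffOp_monomial (n := n + 1) (α := α) ?_ (contDiffOn_pderiv (ha α) i)).add
    (isDiffOp_monomial (n := n + 1) (α := α + Pi.single i 1) ?_ (ha α))).congr fun f hf x hx => ?_
  · exact mem_multiIndices.2 ((mem_multiIndices.1 hα).trans n.le_succ)
  · simpa [mem_multiIndices, Finset.sum_add_distrib] using mem_multiIndices.1 hα
  · have h : A f =ᶠ[nhds x] fun y => ∑ α ∈ multiIndices n, a α y * multiDeriv α f y := by
      filter_upwards [isOpen_compl_singleton.mem_nhds hx] with y hy using hA f hf y hy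
    have hd (α : Fin 3 → ℕ) : DifferentiableAt ℝ (multiDeriv α f) x :=
      (contDiff_multiDeriv hf α).differentiable (by simp) x
    have hda (α : Fin 3 → ℕ) := differentiableAt_of_contDiffOn (ha α) hx
    rw [pderiv_congr h, DeSitter.pderiv, fderiv_fun_sum fun α _ => (hda α).fun_mul (hd α),
      sum_apply]
    refine Finset.sum_congr rfl fun α _ => ?_
    rw [← pderiv_multiDeriv hf, ← pderiv_mul (hda α) (hd α)]
    rfl

theorem IsDiffOp.twistedD {n : ℕ} {A : (R3 → ℂ) → R3 → ℂ} (hA : IsDiffOp n A) :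
    IsDiffOp (n + 1) fun f => twistedD (A f) :=
  ((IsDiffOp.sum Finset.univ fun i _ => (hA.pderiv i).coeff_mul
    (contDiff_coord i).contDiffOn).add (hA.mono n.le_succ)).coeff_mul contDiffOn_inv_norm

theorem isDiffOp_twistedD_iterate (k : ℕ) : IsDiffOp k twistedD^[k] := by
  induction k with
  | zero =>
    refine (isDiffOp_monomial (n := 0) (α := 0) (by simp [mem_multiIndices])
      (contDiffOn_const (c := 1))).congr fun f _ x _ => ?_
    simp [multiDeriv]
  | succ k ih =>
    refine ih.twistedD.congr fun f _ x _ => ?_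
    rw [Function.iterate_succ_apply']

theorem IsDiffOp.exists_bound {n : ℕ} {A : (R3 → ℂ) → R3 → ℂ} (hA : IsDiffOp n A) {a : ℝ}
    (ha : 0 < a) (b : ℝ) : ∃ C, 0 ≤ C ∧ ∀ f, ContDiff ℝ ∞ f → ∀ x : R3, a ≤ ‖x‖ → ‖x‖ ≤ b →
      ‖A f x‖ ≤ C * ∑ α ∈ multiIndices n, ‖multiDeriv α f x‖ := by
  obtain ⟨c, hc, hA⟩ := hA
  choose C hC0 hC using fun α => exists_bound_on_shell (hc α).continuousOn ha b
  refine ⟨∑ α ∈ multiIndices n, C α, Finset.sum_nonneg fun α _ => hC0 α, fun f hf x h1 h2 => ?_⟩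
  rw [hA f hf x (norm_pos_iff.1 (ha.trans_le h1)), Finset.mul_sum]
  refine norm_sum_le_of_le _ fun α hα => ?_
  rw [norm_mul]
  gcongr
  exact (hC α x h1 h2).trans (Finset.single_le_sum (fun β _ => hC0 β) hα)

/-! ### Integration in polar coordinates -/

theorem integral_polar {h : R3 → ℝ} (hh : Integrable h) :
    ∫ x, h x = ∫ r in Set.Ioi (0 : ℝ), r ^ 2 * ∫ ξ : S2, h (r • (ξ : R3)) ∂surf := by
  have hmp := (volume : Measure R3).measurePreserving_homeomorphUnitSphereProd
  have hme := (homeomorphUnitSphereProd R3).measurableEmbedding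
  have hdim : Module.finrank ℝ R3 - 1 = 2 := by simp
  rw [hdim] at hmp
  let H : S2 × Set.Ioi (0 : ℝ) → ℝ := fun p => h ((p.2 : ℝ) • (p.1 : R3))
  have hH (x : ({0}ᶜ : Set R3)) : H (homeomorphUnitSphereProd R3 x) = h x := by
    have hx : ‖(x : R3)‖ ≠ 0 := norm_ne_zero_iff.2 x.2
    simp [H, smul_smul, hx]
  have hint : Integrable H (surf.prod (Measure.volumeIoiPow 2)) := by
    rw [← hmp.integrable_comp_emb hme]
    have : IntegrableOn h {0}ᶜ := hh.integrableOn
    rw [integrableOn_iff_comap_subtypeVal (measurableSet_singleton _).compl] at this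
    exact this.congr (.of_forall fun x => (hH x).symm)
  calc ∫ x, h x = ∫ x : ({0}ᶜ : Set R3), h x ∂(volume.comap Subtype.val) := by
        rw [integral_subtype_comap (measurableSet_singleton _).compl h, restrict_compl_singleton]
    _ = ∫ p, H p ∂(surf.prod (Measure.volumeIoiPow 2)) := by
        rw [← hmp.integral_comp hme]; simp only [hH]
    _ = ∫ r : Set.Ioi (0 : ℝ), ∫ ξ : S2, H (ξ, r) ∂surf ∂(Measure.volumeIoiPow 2) :=
        integral_prod_symm H hint
    _ = _ := by
      simp only [Measure.volumeIoiPow, ENNReal.ofReal]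
      rw [integral_withDensity_eq_integral_smul,
        integral_subtype_comap measurableSet_Ioi
          fun r : ℝ => Real.toNNReal (r ^ 2) • ∫ ξ : S2, h (r • (ξ : R3)) ∂surf,
        setIntegral_congr_fun measurableSet_Ioi fun r hr => ?_]
      · simp only [NNReal.smul_def, Real.coe_toNNReal _ (sq_nonneg r), smul_eq_mul]
      · exact (measurable_subtype_coe.pow_const _).real_toNNReal

/-- The left side is the integral of `g` over the shell 1/2 < |x| < 1, which lies in the unit ball.
-/
theorem integral_shell_le {g : R3 → ℝ} (hg : Continuous g) (hg0 : ∀ x, 0 ≤ g x) :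
    ∫ r in (1 / 2 : ℝ)..1, r ^ 2 * ∫ ξ : S2, g (r • (ξ : R3)) ∂surf
      ≤ ∫ x in Metric.ball (0 : R3) 1, g x := by
  have hball : IntegrableOn g (Metric.ball (0 : R3) 1) :=
    (hg.continuousOn.integrableOn_compact (isCompact_closedBall 0 1)).mono_set
      Metric.ball_subset_closedBall
  let s : Set R3 := Metric.ball 0 1 \ Metric.closedBall 0 (1 / 2)
  have hs : MeasurableSet s := measurableSet_ball.diff measurableSet_closedBall
  have hmem (x : R3) : x ∈ s ↔ ‖x‖ ∈ Set.Ioo (1 / 2 : ℝ) 1 := by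
    simp [s, and_comm]
  have hsub : s ⊆ Metric.ball 0 1 := Set.sdiff_subset
  have hint : Integrable (s.indicator g) := (hball.mono_set hsub).integrable_indicator hs
  calc _ = ∫ x, s.indicator g x := by
        rw [integral_polar hint, intervalIntegral.integral_of_le (by norm_num),
          integral_Ioc_eq_integral_Ioo,
          ← integral_indicator measurableSet_Ioo, ← integral_indicator measurableSet_Ioi]
        congr 1
        funext r
        by_cases hr : r ∈ Set.Ioo (1 / 2 : ℝ) 1
        · have hr0 : 0 < r := by linarith [hr.1]
          rw [Set.indicator_of_mem hr, Set.indicator_of_mem (show r ∈ Set.Ioi 0 from hr0)]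
          congr 2
          funext ξ
          rw [Set.indicator_of_mem]
          rwa [hmem, norm_smul_sphere hr0]
        · rw [Set.indicator_of_notMem hr]
          by_cases hr0 : r ∈ Set.Ioi (0 : ℝ)
          · rw [Set.indicator_of_mem hr0]
            have (ξ : S2) : s.indicator g (r • (ξ : R3)) = 0 := by
              rw [Set.indicator_of_notMem]
              rwa [hmem, norm_smul_sphere hr0]
            simp [this]
          · rw [Set.indicator_of_notMem hr0]
    _ = ∫ x in s, g x := integral_indicator hs
    _ ≤ _ := setIntegral_mono_set hball (.of_forall hg0) (.of_forall hsub)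

/-! ### The Sobolev bound -/

/-- Cauchy–Schwarz in its variance form: with V the volume and I the integral of `g`, expand ∫ (V g
- I)² ≥ 0 and divide by V. -/
theorem sq_setIntegral_ball_le {g : R3 → ℝ} (hg : Continuous g) :
    (∫ x in Metric.ball (0 : R3) 1, g x) ^ 2
      ≤ volume.real (Metric.ball (0 : R3) 1) * ∫ x in Metric.ball (0 : R3) 1, g x ^ 2 := by
  have hball {f : R3 → ℝ} (hf : Continuous f) : IntegrableOn f (Metric.ball (0 : R3) 1) :=
    (hf.continuousOn.integrableOn_compact (isCompact_closedBall 0 1)).mono_set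
      Metric.ball_subset_closedBall
  have hV : 0 < volume.real (Metric.ball (0 : R3) 1) :=
    ENNReal.toReal_pos (Metric.measure_ball_pos volume _ one_pos).ne' measure_ball_lt_top.ne
  set V := volume.real (Metric.ball (0 : R3) 1)
  set I := ∫ x in Metric.ball (0 : R3) 1, g x
  have h : 0 ≤ ∫ x in Metric.ball (0 : R3) 1, (V * g x - I) ^ 2 :=
    integral_nonneg fun x => sq_nonneg _
  have e : ∫ x in Metric.ball (0 : R3) 1, (V * g x - I) ^ 2
      = V ^ 2 * (∫ x in Metric.ball (0 : R3) 1, g x ^ 2) - V * I ^ 2 := by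
    have : ∀ x, (V * g x - I) ^ 2 = V ^ 2 * g x ^ 2 - 2 * V * I * g x + I ^ 2 := fun x => by ring
    simp only [this]
    have h₁ : IntegrableOn (fun x => V ^ 2 * g x ^ 2) (Metric.ball (0 : R3) 1) :=
      hball (by fun_prop)
    have h₂ : IntegrableOn (fun x => 2 * V * I * g x) (Metric.ball (0 : R3) 1) :=
      hball (by fun_prop)
    rw [integral_add (h₁.fun_sub h₂) (hball continuous_const), integral_sub h₁ h₂,
      integral_const_mul, integral_const_mul, setIntegral_const]
    simp only [smul_eq_mul]
    change V ^ 2 * _ - 2 * V * I * I + V * I ^ 2 = _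
    ring
  rw [e] at h
  have : 0 ≤ V * (V * (∫ x in Metric.ball (0 : R3) 1, g x ^ 2) - I ^ 2) := by linarith
  have := nonneg_of_mul_nonneg_right this hV
  linarith

theorem integral_multiDeriv_le_sobolevNorm {u : R3 → ℂ} (hu : ContDiff ℝ ∞ u) {m : ℕ}
    {α : Fin 3 → ℕ} (hα : α ∈ multiIndices m) :
    ∫ x in Metric.ball (0 : R3) 1, ‖multiDeriv α u x‖
      ≤ √(volume.real (Metric.ball (0 : R3) 1)) * sobolevNorm m u := by
  rw [sobolevNorm, ← Real.sqrt_mul measureReal_nonneg]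
  apply Real.le_sqrt_of_sq_le
  refine (sq_setIntegral_ball_le (contDiff_multiDeriv hu α).continuous.norm).trans ?_
  gcongr
  have h0 (β : Fin 3 → ℕ) : 0 ≤ ∫ x in Metric.ball (0 : R3) 1, ‖multiDeriv β u x‖ ^ 2 :=
    integral_nonneg fun x => sq_nonneg _
  refine (Finset.single_le_sum (f := fun β => ∫ x in Metric.ball (0 : R3) 1,
      ‖multiDeriv β u x‖ ^ 2) (s := Finset.piAntidiag Finset.univ (∑ i, α i))
    (fun β _ => h0 β) (by simp)).trans ?_
  exact Finset.single_le_sum (f := fun j => ∑ β ∈ Finset.piAntidiag Finset.univ j,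
      ∫ x in Metric.ball (0 : R3) 1, ‖multiDeriv β u x‖ ^ 2)
    (fun j _ => Finset.sum_nonneg fun β _ => h0 β)
    (Finset.mem_range.2 (Nat.lt_succ_of_le (mem_multiIndices.1 hα)))

theorem continuousOn_radialMoment {f : R3 → ℂ} (hf : ContDiffOn ℝ ∞ f {0}ᶜ) (k : ℕ) :
    ContinuousOn (radialMoment k f) (Set.uIcc (1 / 2 : ℝ) 1) := fun r hr => by
  rw [Set.uIcc_of_le (by norm_num)] at hr
  exact (hasDerivAt_radialMoment hf k (by linarith [hr.1])).continuousAt.continuousWithinAt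

/-- On the shell, D̃^k u is bounded pointwise by the derivatives of u. Polar coordinates turn the
radial integral into one over the ball, and Cauchy–Schwarz passes from L¹ to L². -/
theorem exists_integral_radialMoment_le (k m : ℕ) (hkm : k ≤ m) :
    ∃ C, 0 ≤ C ∧ ∀ u, ContDiff ℝ ∞ u →
      ∫ r in (1 / 2 : ℝ)..1, ‖radialMoment k u r‖ ≤ C * sobolevNorm m u := by
  obtain ⟨C, hC0, hC⟩ :=
    ((isDiffOp_twistedD_iterate k).mono hkm).exists_bound (half_pos one_pos) 1
  refine ⟨2 * C * ((multiIndices m).card * √(volume.real (Metric.ball (0 : R3) 1))),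
    by positivity, fun u hu => ?_⟩
  set G : R3 → ℝ := fun x => ∑ α ∈ multiIndices m, ‖multiDeriv α u x‖ with hG
  have hGc : Continuous G :=
    continuous_finsetSum _ fun α _ => (contDiff_multiDeriv hu α).continuous.norm
  have hG0 (x : R3) : 0 ≤ G x := Finset.sum_nonneg fun α _ => norm_nonneg _
  have hu' := hu.contDiffOn (s := {0}ᶜ)
  -- The factor 2 comes from r ≤ 2 r² for r ≥ 1/2, which trades the weight r of the moment for the
  -- polar density r².
  have hpt : ∀ r ∈ Set.Icc (1 / 2 : ℝ) 1, ‖radialMoment k u r‖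
      ≤ 2 * C * (r ^ 2 * ∫ ξ : S2, G (r • (ξ : R3)) ∂surf) := by
    intro r hr
    have hr0 : 0 < r := by linarith [hr.1]
    have hI : ‖sphereIntegral r (twistedD^[k] u)‖ ≤ C * ∫ ξ : S2, G (r • (ξ : R3)) ∂surf := by
      rw [← integral_const_mul]
      refine norm_integral_le_of_norm_le
        ((integrable_comp_smul_sphere hGc.continuousOn hr0).const_mul C) (.of_forall fun ξ => ?_)
      refine hC u hu _ ?_ ?_ <;> rw [norm_smul_sphere hr0]
      exacts [hr.1, hr.2]
    have hJ : 0 ≤ ∫ ξ : S2, G (r • (ξ : R3)) ∂surf := integral_nonneg fun ξ => hG0 _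
    rw [radialMoment, norm_mul, Complex.norm_real, Real.norm_of_nonneg hr0.le]
    calc r * ‖sphereIntegral r (twistedD^[k] u)‖
        ≤ r * (C * ∫ ξ : S2, G (r • (ξ : R3)) ∂surf) := by gcongr
      _ ≤ (2 * r ^ 2) * (C * ∫ ξ : S2, G (r • (ξ : R3)) ∂surf) := by
          gcongr; nlinarith [hr.1]
      _ = _ := by ring
  have hcontJ : ContinuousOn (fun r : ℝ => ∫ ξ : S2, G (r • (ξ : R3)) ∂surf)
      (Set.uIcc (1 / 2 : ℝ) 1) :=
    (continuous_parametric_integral_of_continuous (μ := surf)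
      (f := fun (r : ℝ) (ξ : S2) => G (r • (ξ : R3))) (by
        change Continuous fun p : ℝ × S2 => G (p.1 • (p.2 : R3)); fun_prop) isCompact_univ
      |>.congr fun r => by simp).continuousOn
  calc ∫ r in (1 / 2 : ℝ)..1, ‖radialMoment k u r‖
      ≤ ∫ r in (1 / 2 : ℝ)..1, 2 * C * (r ^ 2 * ∫ ξ : S2, G (r • (ξ : R3)) ∂surf) :=
        intervalIntegral.integral_mono_on (by norm_num)
          (continuousOn_radialMoment hu' k).norm.intervalIntegrable
          (continuousOn_const.mul ((continuousOn_id.pow 2).mul hcontJ)).intervalIntegrable hpt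
    _ = 2 * C * ∫ r in (1 / 2 : ℝ)..1, r ^ 2 * ∫ ξ : S2, G (r • (ξ : R3)) ∂surf :=
        intervalIntegral.integral_const_mul _ _
    _ ≤ 2 * C * ∫ x in Metric.ball (0 : R3) 1, G x := by
        gcongr; exact integral_shell_le hGc hG0
    _ = 2 * C * ∑ α ∈ multiIndices m, ∫ x in Metric.ball (0 : R3) 1, ‖multiDeriv α u x‖ := by
        rw [hG, integral_finsetSum]
        exact fun α _ => ((contDiff_multiDeriv hu α).continuous.norm.continuousOn.integrableOn_compact
          (isCompact_closedBall 0 1)).mono_set Metric.ball_subset_closedBall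
    _ ≤ 2 * C * ∑ α ∈ multiIndices m,
          √(volume.real (Metric.ball (0 : R3) 1)) * sobolevNorm m u := by
        gcongr with α hα; exact integral_multiDeriv_le_sobolevNorm hu hα
    _ = _ := by rw [Finset.sum_const, nsmul_eq_mul]; ring

/-- The weight 2r - 1 is 0 at r = 1/2 and 1 at r = 1, so only the boundary term on the horizon
survives. The price is one more derivative, whence the Sobolev order k + 1. -/
theorem radialMoment_one_eq {f : R3 → ℂ} (hf : ContDiffOn ℝ ∞ f {0}ᶜ) (k : ℕ) :
    radialMoment k f 1 = ∫ r in (1 / 2 : ℝ)..1,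
      (2 * radialMoment k f r + (2 * (r : ℂ) - 1) * radialMoment (k + 1) f r) := by
  have hd : ∀ r ∈ Set.uIcc (1 / 2 : ℝ) 1,
      HasDerivAt (fun r : ℝ => (2 * (r : ℂ) - 1) * radialMoment k f r)
        (2 * radialMoment k f r + (2 * (r : ℂ) - 1) * radialMoment (k + 1) f r) r := by
    intro r hr
    rw [Set.uIcc_of_le (by norm_num)] at hr
    have hid : HasDerivAt (fun t : ℝ => (t : ℂ)) 1 r := (hasDerivAt_id (r : ℂ)).comp_ofReal
    refine (((hid.const_mul 2).sub_const 1).mul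
      (hasDerivAt_radialMoment hf k (by linarith [hr.1]))).congr_deriv ?_
    simp
  rw [intervalIntegral.integral_eq_sub_of_hasDerivAt hd]
  · norm_num
  · refine ContinuousOn.intervalIntegrable ((continuousOn_const.mul
      (continuousOn_radialMoment hf k)).add (ContinuousOn.mul ?_
      (continuousOn_radialMoment hf (k + 1))))
    exact Continuous.continuousOn (by fun_prop)

theorem exists_twistedTheta_bound (k : ℕ) : ∃ C, 0 < C ∧ ∀ u, ContDiff ℝ ∞ u →
    ‖twistedTheta k u‖ ≤ C * sobolevNorm (k + 1) u := by
  obtain ⟨C₁, h₁, hC₁⟩ := exists_integral_radialMoment_le k (k + 1) k.le_succ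
  obtain ⟨C₂, h₂, hC₂⟩ := exists_integral_radialMoment_le (k + 1) (k + 1) le_rfl
  -- The summand 1 only makes the constant strictly positive.
  refine ⟨‖Y00‖ * (2 * C₁ + C₂) + 1, by positivity, fun u hu => ?_⟩
  have hu' := hu.contDiffOn (s := {0}ᶜ)
  have hi (j : ℕ) : IntervalIntegrable (fun r => ‖radialMoment j u r‖) volume (1 / 2) 1 :=
    (continuousOn_radialMoment hu' j).norm.intervalIntegrable
  have hs : 0 ≤ sobolevNorm (k + 1) u := Real.sqrt_nonneg _
  have h : ‖radialMoment k u 1‖ ≤ (2 * C₁ + C₂) * sobolevNorm (k + 1) u := by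
    rw [radialMoment_one_eq hu' k]
    calc _ ≤ ∫ r in (1 / 2 : ℝ)..1, (2 * ‖radialMoment k u r‖ + ‖radialMoment (k + 1) u r‖) := by
          refine intervalIntegral.norm_integral_le_of_norm_le (by norm_num)
            (.of_forall fun r hr => ?_) (((hi k).const_mul 2).add (hi (k + 1)))
          refine (norm_add_le _ _).trans ?_
          rw [norm_mul, norm_mul, Complex.norm_ofNat]
          have : ‖2 * (r : ℂ) - 1‖ ≤ 1 := by
            have e : 2 * (r : ℂ) - 1 = ((2 * r - 1 : ℝ) : ℂ) := by push_cast; rfl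
            rw [e, Complex.norm_real, Real.norm_eq_abs, abs_le]
            constructor <;> linarith [hr.1, hr.2]
          gcongr
          exact mul_le_of_le_one_left (norm_nonneg _) this
      _ = 2 * (∫ r in (1 / 2 : ℝ)..1, ‖radialMoment k u r‖)
          + ∫ r in (1 / 2 : ℝ)..1, ‖radialMoment (k + 1) u r‖ := by
          rw [intervalIntegral.integral_add ((hi k).const_mul 2) (hi (k + 1)),
            intervalIntegral.integral_const_mul]
      _ ≤ 2 * (C₁ * sobolevNorm (k + 1) u) + C₂ * sobolevNorm (k + 1) u := by
          gcongr
          exacts [hC₁ u hu, hC₂ u hu]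
      _ = _ := by ring
  rw [twistedTheta_eq_radialMoment, norm_mul, norm_pow, norm_neg, norm_one, one_pow, one_mul,
    norm_mul]
  calc _ ≤ ‖Y00‖ * ((2 * C₁ + C₂) * sobolevNorm (k + 1) u) := by gcongr
    _ ≤ _ := by linarith

/-! ### The distribution -/

/-- `∂_i` as a continuous operator on test functions. -/
def pderivCLM (ε : ℝ) (i : Fin 3) : Test ε →L[ℂ] Test ε :=
  TestFunction.lineDerivCLM ℂ (EuclideanSpace.single i (1 : ℝ))

theorem coe_pderivCLM {ε : ℝ} (i : Fin 3) (u : Test ε) : ⇑(pderivCLM ε i u) = pderiv i u := by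
  funext x
  rw [pderivCLM, TestFunction.lineDerivCLM_eq_fderivCLM,
    TestFunction.fderivCLM_apply_of_le _ (by simp)]
  rfl

theorem coe_pderivCLM_pow {ε : ℝ} (i : Fin 3) (n : ℕ) (u : Test ε) :
    ⇑((pderivCLM ε i ^ n) u) = (pderiv i)^[n] u := by
  induction n with
  | zero => rfl
  | succ n ih =>
    rw [pow_succ', mul_apply_eq_comp, coe_pderivCLM, ih, Function.iterate_succ_apply']

/-- `∂^α` as a continuous operator on test functions. -/
def multiDerivCLM (ε : ℝ) (α : Fin 3 → ℕ) : Test ε →L[ℂ] Test ε :=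
  pderivCLM ε 0 ^ α 0 * (pderivCLM ε 1 ^ α 1 * pderivCLM ε 2 ^ α 2)

theorem coe_multiDerivCLM {ε : ℝ} (α : Fin 3 → ℕ) (u : Test ε) :
    ⇑(multiDerivCLM ε α u) = multiDeriv α u := by
  rw [multiDerivCLM, mul_apply_eq_comp, mul_apply_eq_comp,
    coe_pderivCLM_pow, coe_pderivCLM_pow, coe_pderivCLM_pow, multiDeriv]

/-- The functional `g ↦ ∫_{S²} b g dσ` on bounded continuous functions. -/
def sphereFunctional (b : C(S2, ℂ)) : BoundedContinuousFunction R3 ℂ →L[ℂ] ℂ :=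
  have hint (g : BoundedContinuousFunction R3 ℂ) :
      Integrable (fun ξ : S2 => b ξ * g ξ) surf :=
    Continuous.integrable_of_hasCompactSupport (by fun_prop) (HasCompactSupport.of_compactSpace _)
  LinearMap.mkContinuous
    { toFun := fun g => ∫ ξ : S2, b ξ * g ξ ∂surf
      map_add' := fun g h => by
        rw [← integral_add (hint g) (hint h)]; simp only [BoundedContinuousFunction.coe_add,
          Pi.add_apply, mul_add]
      map_smul' := fun c g => by
        rw [RingHom.id_apply, smul_eq_mul, ← integral_const_mul]
        simp only [BoundedContinuousFunction.coe_smul, smul_eq_mul, mul_left_comm] }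
    (‖b‖ * surf.real Set.univ) fun g => by
      refine (norm_integral_le_of_norm_le_const (C := ‖b‖ * ‖g‖) (.of_forall fun ξ => ?_)).trans
        (le_of_eq (by ring))
      rw [norm_mul]
      gcongr
      exacts [b.norm_coe_le_norm ξ, g.norm_coe_le_norm _]

theorem sphereFunctional_apply (b : C(S2, ℂ)) (g : BoundedContinuousFunction R3 ℂ) :
    sphereFunctional b g = ∫ ξ : S2, b ξ * g ξ ∂surf := rfl

/-- On the sphere D̃^k f is a finite combination of the ∂^α f with continuous coefficients, so the
functional is a finite sum of compositions of continuous maps, although D̃^k f itself need not be a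
test function. -/
theorem exists_dist_eq_twistedTheta (ε : ℝ) (k : ℕ) :
    ∃ θ : Dist ε, ∀ f : Test ε, θ f = twistedTheta k f := by
  obtain ⟨a, ha, hD⟩ := isDiffOp_twistedD_iterate k
  let b (α : Fin 3 → ℕ) : C(S2, ℂ) := ⟨fun ξ => a α ξ, by
    simpa using continuous_comp_smul_sphere (ha α).continuousOn one_pos⟩
  refine ⟨((-1) ^ k * Y00) • ∑ α ∈ multiIndices k, sphereFunctional (b α) ∘L
    TestFunction.toBoundedContinuousFunctionCLM ℂ ∘L multiDerivCLM ε α, fun f => ?_⟩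
  rw [twistedTheta, Theta00, integral_const_mul, ← mul_assoc]
  simp only [smul_apply, sum_apply, smul_eq_mul,
    ContinuousLinearMap.comp_apply, sphereFunctional_apply]
  congr 1
  have hcoe (α : Fin 3 → ℕ) (x : R3) :
      TestFunction.toBoundedContinuousFunctionCLM ℂ (multiDerivCLM ε α f) x
        = multiDeriv α f x := by
    rw [← coe_multiDerivCLM]; rfl
  rw [← integral_finsetSum]
  · refine integral_congr_ae (.of_forall fun ξ => ?_)
    simp only [hcoe]
    exact (hD f f.contDiff ξ (ne_zero_of_mem_unit_sphere ξ)).symm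
  · exact fun α _ => Continuous.integrable_of_hasCompactSupport (by fun_prop)
      (HasCompactSupport.of_compactSpace _)

/-! ### Support -/

theorem twistedD_zero : twistedD 0 = 0 := by
  funext x
  simp [twistedD, euler_eq_fderiv]

theorem twistedTheta_eq_zero_of_vanishing {f : R3 → ℂ}
    (hf : ∀ ξ : S2, f =ᶠ[nhds (ξ : R3)] 0) (k : ℕ) : twistedTheta k f = 0 := by
  have h (ξ : S2) : twistedD^[k] f ξ = 0 := by
    rw [(twistedD_iterate_congr (hf ξ) k).eq_of_nhds, Function.iterate_fixed twistedD_zero]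
    rfl
  simp [twistedTheta, Theta00, h]

theorem isVanishingOn_compl_sphere {ε : ℝ} {k : ℕ} {θ : Dist ε}
    (hθ : ∀ f : Test ε, θ f = twistedTheta k f) :
    Distribution.IsVanishingOn (θ : Test ε → ℂ) (Metric.sphere (0 : R3) 1)ᶜ := fun u hu => by
  rw [hθ]
  exact twistedTheta_eq_zero_of_vanishing
    (fun ξ => notMem_tsupport_iff_eventuallyEq.1 fun h => hu h ξ.2) k

/-! ### Nontriviality -/

/-- The radial function `ρ⁻¹ e^ρ`, fixed by `D̃` away from the origin. -/
def expKernel (x : R3) : ℂ := ((‖x‖⁻¹ * Real.exp ‖x‖ : ℝ) : ℂ)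

theorem contDiffOn_expKernel : ContDiffOn ℝ ∞ expKernel {0}ᶜ := by
  have h : ContDiffOn ℝ ∞ (fun x : R3 => ‖x‖) {0}ᶜ := contDiffOn_id.norm ℝ fun _ hx => hx
  exact Complex.ofRealCLM.contDiff.comp_contDiffOn
    ((h.inv fun _ hx => norm_ne_zero_iff.2 hx).mul h.exp)

theorem twistedD_expKernel {x : R3} (hx : x ≠ 0) : twistedD expKernel x = expKernel x := by
  have hn : ‖x‖ ≠ 0 := norm_ne_zero_iff.2 hx
  have hline : HasDerivAt (fun t : ℝ => t • x) x 1 := by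
    simpa using (hasDerivAt_id (1 : ℝ)).smul_const x
  have h1 : HasDerivAt (fun t : ℝ => expKernel (t • x)) (euler expKernel x) 1 := by
    rw [euler_eq_fderiv]
    have hd := (differentiableAt_of_contDiffOn contDiffOn_expKernel hx).hasFDerivAt
    rw [← one_smul ℝ x] at hd
    simpa [Function.comp_def] using hd.comp_hasDerivAt (1 : ℝ) hline
  -- The radial derivative is read off along the ray t ↦ t x at t = 1: ρ∂_ρ(ρ⁻¹ e^ρ) = (ρ - 1) ρ⁻¹
  -- e^ρ.
  have h2 : HasDerivAt (fun t : ℝ => expKernel (t • x))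
      (((‖x‖ - 1) * (‖x‖⁻¹ * Real.exp ‖x‖) : ℝ) : ℂ) 1 := by
    have e1 : HasDerivAt (fun t : ℝ => t * ‖x‖) ‖x‖ 1 := by
      simpa using (hasDerivAt_id (1 : ℝ)).mul_const ‖x‖
    have e2 := ((e1.inv (by simpa using hn)).mul e1.exp).ofReal_comp
    refine (e2.congr_deriv ?_).congr_of_eventuallyEq ?_
    · congr 1
      simp only [one_mul, Pi.inv_apply]
      field_simp
      ring
    · filter_upwards [lt_mem_nhds (zero_lt_one' ℝ)] with t ht
      simp [expKernel, norm_smul, abs_of_pos ht]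
  rw [twistedD, h1.unique h2, expKernel]
  norm_cast
  field_simp
  ring

theorem twistedD_iterate_expKernel (k : ℕ) {x : R3} (hx : x ≠ 0) :
    twistedD^[k] expKernel =ᶠ[nhds x] expKernel := by
  induction k with
  | zero => rfl
  | succ k ih =>
    rw [Function.iterate_succ_apply']
    refine (twistedD_congr ih).trans ?_
    filter_upwards [isOpen_compl_singleton.mem_nhds hx] with y hy using twistedD_expKernel hy

/-- On the sphere D̃^k f is the constant e, so the value is ± Y_00 e times the area of the sphere.
-/
theorem twistedTheta_ne_zero_of_eq_expKernel {f : R3 → ℂ}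
    (hf : ∀ ξ : S2, f =ᶠ[nhds (ξ : R3)] expKernel) (k : ℕ) : twistedTheta k f ≠ 0 := by
  have h (ξ : S2) : twistedD^[k] f ξ = (Real.exp 1 : ℂ) := by
    rw [(twistedD_iterate_congr (hf ξ) k).eq_of_nhds,
      (twistedD_iterate_expKernel k (ne_zero_of_mem_unit_sphere ξ)).eq_of_nhds, expKernel,
      norm_eq_of_mem_sphere ξ]
    simp
  have hσ : surf.real Set.univ ≠ 0 := by
    rw [measureReal_def, ENNReal.toReal_ne_zero]
    exact ⟨Measure.measure_univ_ne_zero.2 (volume : Measure R3).toSphere_ne_zero, measure_ne_top _ _⟩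
  have hY : Y00 ≠ 0 := by
    rw [Y00, Complex.ofReal_ne_zero]
    positivity
  have hv : twistedTheta k f = (-1) ^ k * ((surf.real Set.univ : ℂ) * (Y00 * Real.exp 1)) := by
    simp only [twistedTheta, Theta00, h, integral_const, Complex.real_smul]
  rw [hv]
  refine mul_ne_zero (by simp) (mul_ne_zero (by exact_mod_cast hσ) (mul_ne_zero hY ?_))
  exact_mod_cast (Real.exp_pos 1).ne'

theorem exists_test_eq_expKernel {ε : ℝ} (hε : 0 < ε) :
    ∃ f : Test ε, ∀ ξ : S2, f =ᶠ[nhds (ξ : R3)] expKernel := by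
  have hδ : 0 < min ε 1 := lt_min hε one_pos
  have hδε : min ε 1 ≤ ε := min_le_left _ _
  have hδ1 : min ε 1 ≤ 1 := min_le_right _ _
  set δ := min ε 1
  -- A radial cut-off, equal to 1 near ρ = 1. The outer radius δ/2 with δ ≤ ε keeps the support
  -- inside B_{1+ε}, and δ ≤ 1 keeps it in ρ ≥ 1/2, away from the singularity of the kernel.
  let ψ : ContDiffBump (1 : ℝ) := ⟨δ / 4, δ / 2, by positivity, by linarith⟩
  let F : R3 → ℂ := fun x => (ψ ‖x‖ : ℂ) * expKernel x
  have hsupp : Function.support F ⊆ Metric.closedBall 0 (1 + δ / 2) \ Metric.ball 0 (1 / 2) := by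
    intro x hx
    have hψ : ψ ‖x‖ ≠ 0 := fun h => hx (by simp [F, h])
    have h : ‖x‖ ∈ Metric.ball (1 : ℝ) (δ / 2) := by
      rw [← ψ.support_eq]; exact hψ
    rw [Real.ball_eq_Ioo] at h
    constructor
    · simpa using h.2.le
    · have := h.1
      simp only [Metric.mem_ball, dist_zero_right, not_lt]
      linarith
  have htsupp : tsupport F ⊆ Metric.closedBall 0 (1 + δ / 2) \ Metric.ball 0 (1 / 2) :=
    closure_minimal hsupp (Metric.isClosed_closedBall.sdiff Metric.isOpen_ball)
  have hsmooth : ContDiff ℝ ∞ F := by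
    rw [contDiff_iff_contDiffAt]
    intro x
    by_cases hx : x = 0
    · have h0 : x ∉ tsupport F := fun h => (htsupp h).2 (by simp [hx])
      exact contDiffAt_const.congr_of_eventuallyEq (notMem_tsupport_iff_eventuallyEq.1 h0)
    · exact (Complex.ofRealCLM.contDiff.contDiffAt.comp x
        (ψ.contDiff.contDiffAt.comp x (contDiffAt_norm ℝ hx))).mul
        (contDiffOn_expKernel.contDiffAt (isOpen_compl_singleton.mem_nhds hx))
  refine ⟨⟨F, hsmooth, ?_, ?_⟩, fun ξ => ?_⟩
  · exact (isCompact_closedBall (0 : R3) (1 + δ / 2)).of_isClosed_subset (isClosed_tsupport F)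
      (htsupp.trans Set.sdiff_subset)
  · refine (htsupp.trans Set.sdiff_subset).trans (Metric.closedBall_subset_ball ?_)
    linarith
  · have hone : ψ =ᶠ[nhds ‖(ξ : R3)‖] 1 := by
      rw [norm_eq_of_mem_sphere ξ]; exact ψ.eventuallyEq_one
    filter_upwards [continuous_norm.continuousAt.eventually hone] with x hx
    change (ψ ‖x‖ : ℂ) * expKernel x = expKernel x
    rw [hx]
    simp

end

end DeSitter

/-- For every `ε > 0` and every `k`, the functional `D̃^k Θ_00` is a distribution on `B_{1+ε}`. It is
a nonzero quasinormal co-mode of Sobolev order `k + 1` at the frequency `s = -k - 1`, and its support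
is contained in the unit sphere, the cosmological horizon. -/
theorem mainTheorem7 (ε : ℝ) (hε : 0 < ε) (k : ℕ) :
    ∃ θ : DeSitter.Dist ε,
      (∀ f : DeSitter.Test ε, θ f = DeSitter.twistedTheta k f) ∧
      DeSitter.IsCoMode (k + 1) (-(k : ℂ) - 1) θ ∧
      θ ≠ 0 ∧
      Distribution.dsupport (θ : DeSitter.Test ε → ℂ) ⊆ Metric.sphere (0 : DeSitter.R3) 1 := by
  obtain ⟨θ, hθ⟩ := DeSitter.exists_dist_eq_twistedTheta ε k
  refine ⟨θ, hθ, ⟨?_, ?_, fun u => ?_⟩, fun h0 => ?_, ?_⟩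
  · simp only [Complex.sub_re, Complex.neg_re, Complex.natCast_re, Complex.one_re]
    push_cast
    linarith
  · obtain ⟨C, hC, h⟩ := DeSitter.exists_twistedTheta_bound k
    exact ⟨C, hC, fun u => by rw [hθ]; exact h u u.contDiff⟩
  · rw [hθ]
    exact DeSitter.twistedTheta_opL u.contDiff k
  · obtain ⟨f, hf⟩ := DeSitter.exists_test_eq_expKernel hε
    refine DeSitter.twistedTheta_ne_zero_of_eq_expKernel hf k ?_
    rw [← hθ, h0]
    rfl
  -- The support is the intersection of the closed sets off which `θ` vanishes, and the sphere is
  -- one of them.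
  · exact Set.sInter_subset_of_mem
      ⟨DeSitter.isVanishingOn_compl_sphere hθ, Metric.isClosed_sphere⟩
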